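/- Let $\Gamma$ be a connected compact metric graph (finitely many vertices and edges, each edge $e$ identified with an interval $[0,\ell_e]$, $0<\ell_e<\infty$; loops and multiple edges allowed) and let $V_D$ be a non-empty set of vertices. Write $|\cdot|$ for the length measure on $\Gamma$. For $u\in L^1(\Gamma)$ with given values $u(\mathrm v)$, $\mathrm v\in V_D$, let $$\|u'\|=\sup_z\Big\{\sum_{\mathrm v\in V_D}u(\mathrm v)\,F_z(\mathrm v)-\sum_{e}\int_0^{\ell_e}u_e\,z_e'\,dx\Big\},$$ where the supremum is over fields $z=(z_e)_e$ with $z_e\in C^1([0,\ell_e])$, $|z_e|\le 1$, whose net flow into $\mathrm v$, $F_z(\mathrm v)=\sum_{e\text{ ends at }\mathrm v}z_e(\ell_e)-\sum_{e\text{ starts at }\mathrm v}z_e(0)$, vanishes at every vertex $\mathrm v\notin V_D$. (Thus $\|u'\|$ is the sum of the total variations of the $u_e$ in the open edges, plus $\sum_\varepsilon|a_\varepsilon-u(\mathrm v)|$ at each $\mathrm v\in V_D$ and $\min_{c\in\mathbb R}\sum_\varepsilon|a_\varepsilon-c|$ at each vertex $\mathrm v\notin V_D$, where $a_\varepsilon$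 are the traces of $u$ along the edge ends $\varepsilon$ at $\mathrm v$.) Let $BV(\Gamma)$ be the set of $u\in L^1(\Gamma)$ with $u_e\in BV(0,\ell_e)$ for every $e$, and for measurable $D\subset\Gamma$ let $\mathrm{Per}(D)=\|\chi_D'\|$. Put $$\Lambda_1(\Gamma,V_D)=\inf\Big\{\frac{\|v'\|}{\|v\|_{L^1(\Gamma)}}\colon v\in BV(\Gamma),\ v=0\text{ on }V_D,\ v\ne 0\text{ in }L^1(\Gamma)\Big\},$$ $$\lambda=\inf\Big\{\frac{\mathrm{Per}(D)}{|D|}\colon D\subset\Gamma\text{ measurable},\ D\cap V_D=\emptyset,\ |D|>0\Big\},$$ with $\inf\emptyset=+\infty$, and call a set $D$ attaining the second infimum a Cheeger set. Then $$\Lambda_1(\Gamma,V_D)=\lambda .$$ Moreover, if $u$ is a minimizer for $\Lambda_1(\Gamma,V_D)$ and $E_t=\{x\in\Gamma\colon u(x)>t\}$, then for almost every $t>0$ one has $\mathrm{Per}(E_t)=\lambda\,|E_t|$, and $E_t$ is a Cheeger set whenever $|E_t|>0$. -/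

import Mathlib

open Set MeasureTheory
open scoped ENNReal

noncomputable section

/-- A metric graph with vertices `V` and edges `E` (loops and multiple edges are allowed).
Each edge carries an orientation and a finite positive length. -/
structure MetricGraph (V E : Type*) where
  src : E → V
  tgt : E → V
  len : E → ℝ
  len_pos : ∀ e, 0 < len e

namespace MetricGraph

variable {V E : Type*}

/-- Any two vertices are joined by a walk (edges may be traversed in both directions). -/
def Connected (Γ : MetricGraph V E) : Prop :=
  ∀ v w : V, Relation.EqvGen (fun a b => ∃ e, Γ.src e = a ∧ Γ.tgt e = b) v w

/-- The points of the metric graph: the vertices, and the interior points of the edges. -/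
inductive Point (Γ : MetricGraph V E) where
  | vertex (v : V) : Point Γ
  | inner (e : E) (x : ℝ) (hx : x ∈ Ioo 0 (Γ.len e)) : Point Γ

open Classical in
/-- The parametrization of the edge `e` by its coordinate `x ∈ [0, len e]`; the value `0` gives the
initial vertex and `len e` the terminal vertex. (Outside `[0, len e]` it is constant.) -/
def coord (Γ : MetricGraph V E) (e : E) (x : ℝ) : Γ.Point :=
  if hx : x ∈ Ioo 0 (Γ.len e) then .inner e x hx
  else if x ≤ 0 then .vertex (Γ.src e) else .vertex (Γ.tgt e)

/-- A set of points is measurable when its trace on every edge is a Borel set of coordinates. -/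
instance (Γ : MetricGraph V E) : MeasurableSpace Γ.Point :=
  ⨅ e, (inferInstance : MeasurableSpace ℝ).map (Γ.coord e)

theorem measurable_coord (Γ : MetricGraph V E) (e : E) : Measurable (Γ.coord e) := by
  intro s hs
  exact (MeasurableSpace.measurableSet_iInf.mp hs) e

/-- The length measure: Lebesgue measure on each edge. -/
def lengthMeasure (Γ : MetricGraph V E) : Measure Γ.Point :=
  Measure.sum fun e => (volume.restrict (Ioo 0 (Γ.len e))).map (Γ.coord e)

variable [Fintype E]

open Classical in
/-- The net flow of the field `z` into the vertex `v` (a loop contributes twice). -/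
def flux (Γ : MetricGraph V E) (z : E → ℝ → ℝ) (v : V) : ℝ :=
  ∑ e with Γ.tgt e = v, z e (Γ.len e) - ∑ e with Γ.src e = v, z e 0

/-- Test fields: `C¹` on each closed edge, bounded by `1`, and satisfying the Kirchhoff condition at
every vertex outside `W`. At the vertices of `W` there is no condition. -/
structure IsTestField (Γ : MetricGraph V E) (W : Set V) (z : E → ℝ → ℝ) : Prop where
  contDiff : ∀ e, ContDiff ℝ 1 (z e)
  bound : ∀ e, ∀ x ∈ Icc 0 (Γ.len e), |z e x| ≤ 1
  kirchhoff : ∀ v, v ∉ W → Γ.flux z v = 0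

/-- The distributional derivative of `u` applied to the field `z`. By the Kirchhoff condition, for a
test field the vertex values of `u` enter only at the vertices of `W`. -/
def derivPairing (Γ : MetricGraph V E) (u : Γ.Point → ℝ) (z : E → ℝ → ℝ) : ℝ :=
  ∑ e, (u (.vertex (Γ.tgt e)) * z e (Γ.len e) - u (.vertex (Γ.src e)) * z e 0
    - ∫ x in (0 : ℝ)..Γ.len e, u (Γ.coord e x) * deriv (z e) x)

/-- The total variation `‖u'‖` on the graph, where the values of `u` at the vertices of `W` are
prescribed data: if `u` has trace `a_ε` along the edge end `ε`, a vertex `v ∈ W` contributes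
`∑ |a_ε - u v|` (sum over the edge ends at `v`), while a vertex `v ∉ W` contributes
`min_c ∑ |a_ε - c|`, so that the total variation does not see the value at `v`.
For `W = ∅` this is the total variation of the `L¹`-class of `u`. -/
def totalVariation (Γ : MetricGraph V E) (W : Set V) (u : Γ.Point → ℝ) : ℝ≥0∞ :=
  ⨆ (z : E → ℝ → ℝ) (_ : Γ.IsTestField W z), ENNReal.ofReal (Γ.derivPairing u z)

/-- Functions of bounded variation on the graph. -/
def MemBV (Γ : MetricGraph V E) (u : Γ.Point → ℝ) : Prop :=
  Integrable u Γ.lengthMeasure ∧ Γ.totalVariation ∅ u ≠ ⊤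

/-- The competitors for `Λ₁`: `u ∈ BV(Γ)`, `u = 0` on `W`, and `u ≠ 0` as an element of `L¹(Γ)`. -/
structure Admissible (Γ : MetricGraph V E) (W : Set V) (u : Γ.Point → ℝ) : Prop where
  memBV : Γ.MemBV u
  dirichlet : ∀ v ∈ W, u (.vertex v) = 0
  ne_zero : ¬ u =ᵐ[Γ.lengthMeasure] 0

/-- The quotient `‖u'‖ / ‖u‖_{L¹}`. -/
def rayleigh (Γ : MetricGraph V E) (W : Set V) (u : Γ.Point → ℝ) : ℝ≥0∞ :=
  Γ.totalVariation W u / eLpNorm u 1 Γ.lengthMeasure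

/-- The first eigenvalue `Λ₁(Γ, W)` of the 1-Laplacian with Dirichlet condition on `W`. -/
def firstEigenvalue (Γ : MetricGraph V E) (W : Set V) : ℝ≥0∞ :=
  ⨅ (u : Γ.Point → ℝ) (_ : Γ.Admissible W u), Γ.rayleigh W u

/-- The perimeter of a set: the total variation of its indicator function. -/
def perimeter (Γ : MetricGraph V E) (W : Set V) (D : Set Γ.Point) : ℝ≥0∞ :=
  Γ.totalVariation W (D.indicator 1)

/-- The competitors for the Cheeger constant: Lebesgue measurable sets of positive length
disjoint from `W`. -/
structure CheegerAdmissible (Γ : MetricGraph V E) (W : Set V) (D : Set Γ.Point) : Prop where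
  measurable : NullMeasurableSet D Γ.lengthMeasure
  disjoint : Disjoint D (Point.vertex '' W)
  pos : 0 < Γ.lengthMeasure D

/-- The Cheeger constant `inf Per(D) / |D|`. -/
def cheegerConstant (Γ : MetricGraph V E) (W : Set V) : ℝ≥0∞ :=
  ⨅ (D : Set Γ.Point) (_ : Γ.CheegerAdmissible W D), Γ.perimeter W D / Γ.lengthMeasure D

/-- Cheeger sets: the sets that attain the Cheeger constant. -/
def IsCheegerSet (Γ : MetricGraph V E) (W : Set V) (D : Set Γ.Point) : Prop :=
  Γ.CheegerAdmissible W D ∧ Γ.perimeter W D / Γ.lengthMeasure D = Γ.cheegerConstant W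

end MetricGraph

end

/-! Inserting indicator functions gives Λ₁ ≤ λ. The converse combines the layer-cake formula for
‖u‖₁ with the coarea inequality ∫ Per(E_t) dt ≤ ‖u'‖: for t > 0 the set E_t competes for λ, and for
t < 0 its complement does, with no larger perimeter. For a minimizer the integrated inequalities are
equalities, hence so are the pointwise ones for almost every t.

The coarea inequality rests on calibration. For a step function a single field is extremal for all
superlevel sets at once (`exists_calibration`): the sign of the jump inside the edges and at V_D,
and at any other vertex a balanced field that is 1 on the upper half of the traces and -1 on the
lower half (`exists_balanced_calibration`). The pairing with a fixed field is linear, so it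
integrates exactly over the levels (`lintegral_stepPairing_cut`).

A general u enters through weighted averages over small cells. Their pairing with a discrete field
equals the pairing of u with a C¹ field (`derivPairing_smoothField`), hence is at most ‖u'‖.
Lebesgue differentiation yields lower semicontinuity as the cells shrink (`perimeter_le_liminf`),
and Fatou's lemma concludes (`exists_measurable_perimeter_le`). The liminf serves as a measurable
majorant of Per(E_t), so measurability of the perimeter in t is never needed. -/

/-! ### Cuts at a level and the calibration at a single vertex. -/

/-- The value at `y` of the indicator function of the superlevel set `{y | t < y}`. -/
noncomputable def cut (t y : ℝ) : ℝ := if t < y then 1 else 0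

theorem cut_of_lt {t y : ℝ} (h : t < y) : cut t y = 1 := if_pos h

theorem cut_of_le {t y : ℝ} (h : y ≤ t) : cut t y = 0 := if_neg h.not_gt

theorem cut_mono (t : ℝ) {x y : ℝ} (h : x ≤ y) : cut t x ≤ cut t y := by
  unfold cut
  split_ifs <;> linarith

theorem cut_nonneg (t y : ℝ) : 0 ≤ cut t y := by
  unfold cut
  split_ifs <;> norm_num

theorem cut_le_one (t y : ℝ) : cut t y ≤ 1 := by
  unfold cut
  split_ifs <;> norm_num

/-- Since the cut is monotone, the sign of the jump of the uncut values calibrates every level t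
simultaneously. -/
theorem sign_mul_cut_sub_cut (t x y : ℝ) :
    (SignType.sign (x - y) : ℝ) * (cut t x - cut t y) = |cut t x - cut t y| := by
  rcases lt_trichotomy x y with h | h | h
  · rw [sign_neg (by linarith), abs_of_nonpos (by linarith [cut_mono t h.le])]
    simp
  · subst h
    simp
  · rw [sign_pos (by linarith), abs_of_nonneg (by linarith [cut_mono t h.le])]
    simp

theorem abs_sign_le_one (x : ℝ) : |(SignType.sign x : ℝ)| ≤ 1 := by
  rcases lt_trichotomy x 0 with h | h | h
  · simp [sign_neg h]
  · simp [h]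
  · simp [sign_pos h]

theorem mul_le_abs_of_abs_le_one {x y : ℝ} (h : |x| ≤ 1) : x * y ≤ |y| :=
  calc x * y ≤ |x * y| := le_abs_self _
    _ = |x| * |y| := abs_mul _ _
    _ ≤ 1 * |y| := by gcongr
    _ = |y| := one_mul _

/-- A balanced field with values in `[-1, 1]` that is extremal on all superlevel sets of `a`. -/
theorem exists_balanced_calibration {ι : Type*} (a : ι → ℝ) (s : Finset ι) :
    ∃ y : ι → ℝ, (∀ i, |y i| ≤ 1) ∧ ∑ i ∈ s, y i = 0 ∧
      ∀ t, ∑ i ∈ s, y i * cut t (a i)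
        = min (∑ i ∈ s, cut t (a i)) (∑ i ∈ s, (1 - cut t (a i))) := by
  classical
  induction hk : s.card using Nat.strong_induction_on generalizing s with
  | _ k ih =>
  rcases s.eq_empty_or_nonempty with rfl | hs
  · exact ⟨0, by simp, by simp, by simp⟩
  obtain ⟨p, hp, hpmax⟩ := s.exists_max_image a hs
  rcases (s.erase p).eq_empty_or_nonempty with h0 | hs'
  · have hsp : s = {p} := by
      rw [← Finset.insert_erase hp, h0, insert_empty_eq]
    refine ⟨0, by simp, by simp, fun t => ?_⟩
    subst hsp
    simp only [Finset.sum_singleton, cut]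
    split_ifs <;> simp
  obtain ⟨q, hq, hqmin⟩ := (s.erase p).exists_min_image a hs'
  have hqp : q ≠ p := Finset.ne_of_mem_erase hq
  obtain ⟨y, hy1, hy0, hyt⟩ := ih ((s.erase p).erase q).card (by
    rw [← hk]
    exact (Finset.card_lt_card (Finset.erase_ssubset hq)).trans
      (Finset.card_lt_card (Finset.erase_ssubset hp))) _ rfl
  set r := (s.erase p).erase q with hr
  have hsum : ∀ f : ι → ℝ, ∑ i ∈ s, f i = f p + (f q + ∑ i ∈ r, f i) := fun f => by
    rw [hr, Finset.add_sum_erase _ _ hq, Finset.add_sum_erase _ _ hp]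
  have hmem : ∀ i ∈ r, i ≠ p ∧ i ≠ q ∧ a i ≤ a p ∧ a q ≤ a i := fun i hi => by
    obtain ⟨h1, h2⟩ := Finset.mem_erase.mp hi
    exact ⟨Finset.ne_of_mem_erase h2, h1, hpmax i (Finset.mem_of_mem_erase h2), hqmin i h2⟩
  -- Send one unit from the smallest to the largest value, which preserves the balance, and use
  -- induction for the remaining indices.
  let y' : ι → ℝ := fun i => if i = p then 1 else if i = q then -1 else y i
  have hy'p : y' p = 1 := by simp [y']
  have hy'q : y' q = -1 := by simp [y', hqp]
  have hy'r : ∀ i ∈ r, y' i = y i := fun i hi => by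
    simp [y', (hmem i hi).1, (hmem i hi).2.1]
  refine ⟨y', fun i => ?_, ?_, fun t => ?_⟩
  · simp only [y']
    split_ifs
    · simp
    · simp
    · exact hy1 i
  · rw [hsum, hy'p, hy'q, Finset.sum_congr rfl hy'r, hy0]
    norm_num
  · have hr' : ∑ i ∈ r, y' i * cut t (a i) = ∑ i ∈ r, y i * cut t (a i) :=
      Finset.sum_congr rfl fun i hi => by rw [hy'r i hi]
    rw [hsum (fun i => y' i * cut t (a i)), hsum (fun i => cut t (a i)),
      hsum (fun i => 1 - cut t (a i)), hr', hyt, hy'p, hy'q]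
    have hpos : 0 ≤ ∑ i ∈ r, cut t (a i) := Finset.sum_nonneg fun i _ => cut_nonneg t _
    have hpos' : 0 ≤ ∑ i ∈ r, (1 - cut t (a i)) :=
      Finset.sum_nonneg fun i _ => by linarith [cut_le_one t (a i)]
    -- If t separates q from p, the pairing and both counts grow by one. Otherwise all values lie on
    -- the same side of t, and both sides of the identity are 0.
    by_cases hpt : t < a p
    · by_cases hqt : t < a q
      · have h0 : ∑ i ∈ r, (1 - cut t (a i)) = 0 := Finset.sum_eq_zero fun i hi => by
          simp [cut, hqt.trans_le (hmem i hi).2.2.2]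
        rw [h0, cut_of_lt hpt, cut_of_lt hqt]
        rw [min_eq_right (by linarith), min_eq_right (by linarith)]
        norm_num
      · rw [cut_of_lt hpt, cut_of_le (not_lt.mp hqt)]
        simp only [mul_zero, zero_add, sub_self, sub_zero, mul_one]
        rw [min_add_add_left]
    · have hle := not_lt.mp hpt
      have hqt : ¬ t < a q := not_lt.mpr ((hpmax q (Finset.mem_of_mem_erase hq)).trans hle)
      have h0 : ∑ i ∈ r, cut t (a i) = 0 := Finset.sum_eq_zero fun i hi => by
        simp [cut, not_lt.mpr ((hmem i hi).2.2.1.trans hle)]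
      rw [h0, cut_of_le hle, cut_of_le (not_lt.mp hqt)]
      rw [min_eq_left (by linarith), min_eq_left (by linarith)]
      norm_num

/-- The optimality half for `exists_balanced_calibration`. The second bound uses the balance to move
the pairing to the complement, with y negated. -/
theorem sum_mul_cut_le_min {ι : Type*} (a : ι → ℝ) (s : Finset ι) (y : ι → ℝ)
    (hy : ∀ i ∈ s, |y i| ≤ 1) (h0 : ∑ i ∈ s, y i = 0) (t : ℝ) :
    ∑ i ∈ s, y i * cut t (a i)
      ≤ min (∑ i ∈ s, cut t (a i)) (∑ i ∈ s, (1 - cut t (a i))) := by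
  refine le_min (Finset.sum_le_sum fun i hi => ?_) ?_
  · nlinarith [abs_le.mp (hy i hi), cut_nonneg t (a i)]
  · have : ∑ i ∈ s, y i * cut t (a i) = ∑ i ∈ s, -y i * (1 - cut t (a i)) := by
      rw [← add_zero (∑ i ∈ s, -y i * (1 - cut t (a i))), ← h0, ← Finset.sum_add_distrib]
      exact Finset.sum_congr rfl fun i _ => by ring
    rw [this]
    refine Finset.sum_le_sum fun i hi => ?_
    nlinarith [abs_le.mp (hy i hi), cut_le_one t (a i)]

theorem sum_range_mul_sub_succ (c w : ℕ → ℝ) (n : ℕ) :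
    ∑ i ∈ Finset.range (n + 1), c i * (w (i + 1) - w i)
      = c n * w (n + 1) - c 0 * w 0
        - ∑ i ∈ Finset.range n, w (i + 1) * (c (i + 1) - c i) := by
  induction n with
  | zero => simp; ring
  | succ n ih =>
    rw [Finset.sum_range_succ, ih, Finset.sum_range_succ _ n]
    ring

/-! ### Calibration of step functions on the graph. -/

namespace MetricGraph

variable {V E : Type*} [Fintype E]

/-- The derivative pairing of the function that takes the value `c e i` on the `i`-th of `n` cells
of the edge `e` and `u v` at the vertex `v`, with a field that takes the values `w e 0, …, w e n`
at the ends of the cells. -/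
def stepPairing (Γ : MetricGraph V E) (n : ℕ) (c : E → ℕ → ℝ) (u : V → ℝ) (w : E → ℕ → ℝ) : ℝ :=
  ∑ e, (u (Γ.tgt e) * w e n - u (Γ.src e) * w e 0
    - ∑ i ∈ Finset.range n, c e i * (w e (i + 1) - w e i))

open Classical in
/-- Discrete test fields, given by their values at the ends of the `n` cells of each edge. -/
structure IsDiscreteField (Γ : MetricGraph V E) (W : Set V) (n : ℕ) (w : E → ℕ → ℝ) : Prop where
  bound : ∀ e, ∀ i ≤ n, |w e i| ≤ 1
  kirchhoff : ∀ v, v ∉ W → ∑ e with Γ.tgt e = v, w e n - ∑ e with Γ.src e = v, w e 0 = 0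

/-- The vertex at an edge end: `(e, false)` is the initial and `(e, true)` the terminal end. -/
def endVertex (Γ : MetricGraph V E) (ε : E × Bool) : V :=
  if ε.2 then Γ.tgt ε.1 else Γ.src ε.1

/-- The value of the step function `c` at an edge end, for a subdivision into `n + 1` cells. -/
def endTrace (n : ℕ) (c : E → ℕ → ℝ) (ε : E × Bool) : ℝ :=
  if ε.2 then c ε.1 n else c ε.1 0

/-- The flow out of the vertex through an edge end. -/
def outflow (n : ℕ) (w : E → ℕ → ℝ) (ε : E × Bool) : ℝ :=
  if ε.2 then -w ε.1 n else w ε.1 0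

/-- Summation by parts on each edge: the field is now paired with the jumps of the step function, at
the edge ends relative to the vertex value and inside relative to the neighbouring cell. These jumps
can be optimized separately, apart from the Kirchhoff coupling. -/
theorem stepPairing_succ (Γ : MetricGraph V E) (n : ℕ) (c : E → ℕ → ℝ) (u : V → ℝ)
    (w : E → ℕ → ℝ) :
    Γ.stepPairing (n + 1) c u w
      = ∑ ε, outflow (n + 1) w ε * (endTrace n c ε - u (Γ.endVertex ε))
        + ∑ e, ∑ i ∈ Finset.range n, w e (i + 1) * (c e (i + 1) - c e i) := by
  rw [Fintype.sum_prod_type, ← Finset.sum_add_distrib]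
  refine Finset.sum_congr rfl fun e _ => ?_
  rw [sum_range_mul_sub_succ, Fintype.sum_bool]
  simp only [outflow, endTrace, endVertex, if_true, Bool.false_eq_true, if_false]
  ring

open Classical in
theorem sum_outflow (Γ : MetricGraph V E) (n : ℕ) (w : E → ℕ → ℝ) (v : V) :
    ∑ ε with Γ.endVertex ε = v, outflow n w ε
      = -(∑ e with Γ.tgt e = v, w e n - ∑ e with Γ.src e = v, w e 0) := by
  simp only [Finset.sum_filter]
  rw [Fintype.sum_prod_type, ← Finset.sum_sub_distrib, ← Finset.sum_neg_distrib]
  refine Finset.sum_congr rfl fun e _ => ?_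
  rw [Fintype.sum_bool]
  simp only [outflow, endVertex, if_true, Bool.false_eq_true, if_false]
  split_ifs <;> ring

/-- For a step function there is a discrete test field that is extremal for the derivative pairing
with all superlevel sets simultaneously. -/
theorem exists_calibration [Finite V] (Γ : MetricGraph V E) (W : Set V) (n : ℕ)
    (c : E → ℕ → ℝ) (u : V → ℝ) :
    ∃ w, Γ.IsDiscreteField W (n + 1) w ∧ ∀ t w', Γ.IsDiscreteField W (n + 1) w' →
      Γ.stepPairing (n + 1) (fun e i => cut t (c e i)) (fun v => cut t (u v)) w'
        ≤ Γ.stepPairing (n + 1) (fun e i => cut t (c e i)) (fun v => cut t (u v)) w := by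
  classical
  have := Fintype.ofFinite V
  choose y hy1 hy0 hyt using fun v : V =>
    exists_balanced_calibration (endTrace n c) {ε | Γ.endVertex ε = v}
  -- Y prescribes the outflow at each edge end. On W the ends are independent, so the sign of the
  -- jump is allowed; elsewhere the balanced field satisfies the Kirchhoff condition.
  let Y : E × Bool → ℝ := fun ε =>
    if Γ.endVertex ε ∈ W then (SignType.sign (endTrace n c ε - u (Γ.endVertex ε)) : ℝ)
    else y (Γ.endVertex ε) ε
  have hY1 : ∀ ε, |Y ε| ≤ 1 := fun ε => by
    simp only [Y]
    split_ifs
    · exact abs_sign_le_one _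
    · exact hy1 _ _
  -- Index i is the boundary between the cells i - 1 and i. The minus sign at n + 1 appears because
  -- outflow at a terminal end runs against the orientation.
  let w : E → ℕ → ℝ := fun e i =>
    if i = 0 then Y (e, false) else if i = n + 1 then -Y (e, true)
    else (SignType.sign (c e i - c e (i - 1)) : ℝ)
  have hout : ∀ ε, outflow (n + 1) w ε = Y ε := by
    rintro ⟨e, b⟩
    cases b <;> simp [outflow, w]
  have hfib : ∀ v, v ∉ W → ∀ ε ∈ ({ε | Γ.endVertex ε = v} : Finset (E × Bool)), Y ε = y v ε :=
    fun v hv ε hε => by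
      have : Γ.endVertex ε = v := by simpa using hε
      simp [Y, this, hv]
  have hw : Γ.IsDiscreteField W (n + 1) w := by
    refine ⟨fun e i _ => ?_, fun v hv => ?_⟩
    · simp only [w]
      split_ifs
      · exact hY1 _
      · rw [abs_neg]
        exact hY1 _
      · exact abs_sign_le_one _
    · rw [← neg_eq_zero, ← sum_outflow]
      simp only [hout]
      rw [Finset.sum_congr rfl (hfib v hv), hy0]
  refine ⟨w, hw, fun t w' hw' => ?_⟩
  have htr : ∀ ε, endTrace n (fun e i => cut t (c e i)) ε = cut t (endTrace n c ε) := by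
    rintro ⟨e, b⟩
    cases b <;> simp [endTrace]
  have hout1 : ∀ ε, |outflow (n + 1) w' ε| ≤ 1 := by
    rintro ⟨e, b⟩
    cases b
    · simpa [outflow] using hw'.bound e 0 (Nat.zero_le _)
    · simpa [outflow] using hw'.bound e (n + 1) le_rfl
  rw [stepPairing_succ, stepPairing_succ]
  refine add_le_add ?_ (Finset.sum_le_sum fun e _ => Finset.sum_le_sum fun i hi => ?_)
  · rw [← Finset.sum_fiberwise (g := Γ.endVertex), ← Finset.sum_fiberwise (g := Γ.endVertex)]
    refine Finset.sum_le_sum fun v _ => ?_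
    by_cases hv : v ∈ W
    · refine Finset.sum_le_sum fun ε hε => ?_
      have hεv : Γ.endVertex ε = v := by simpa using hε
      rw [hout, htr]
      have hYε : Y ε = (SignType.sign (endTrace n c ε - u (Γ.endVertex ε)) : ℝ) := by
        simp [Y, hεv, hv]
      rw [hYε, sign_mul_cut_sub_cut]
      exact mul_le_abs_of_abs_le_one (hout1 ε)
    -- Off W the outflows sum to zero, so the value at the vertex drops out and only the traces
    -- remain.
    · have key : ∀ w'', Γ.IsDiscreteField W (n + 1) w'' →
          ∑ ε with Γ.endVertex ε = v, outflow (n + 1) w'' ε *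
            (endTrace n (fun e i => cut t (c e i)) ε - cut t (u (Γ.endVertex ε)))
          = ∑ ε with Γ.endVertex ε = v, outflow (n + 1) w'' ε * cut t (endTrace n c ε) := by
        intro w'' hw''
        have h0 : (∑ ε with Γ.endVertex ε = v, outflow (n + 1) w'' ε) * cut t (u v) = 0 := by
          rw [sum_outflow, hw''.kirchhoff v hv]
          simp
        rw [← sub_zero (∑ ε with Γ.endVertex ε = v, _ * cut t (endTrace n c ε)), ← h0,
          Finset.sum_mul, ← Finset.sum_sub_distrib]
        refine Finset.sum_congr rfl fun ε hε => ?_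
        have hεv : Γ.endVertex ε = v := by simpa using hε
        rw [htr, hεv]
        ring
      rw [key w' hw', key w hw]
      have h1 : ∑ ε with Γ.endVertex ε = v, outflow (n + 1) w ε * cut t (endTrace n c ε)
          = ∑ ε with Γ.endVertex ε = v, y v ε * cut t (endTrace n c ε) :=
        Finset.sum_congr rfl fun ε hε => by rw [hout, hfib v hv ε hε]
      rw [h1, hyt]
      refine sum_mul_cut_le_min _ _ _ (fun ε _ => hout1 ε) ?_ t
      rw [sum_outflow, hw'.kirchhoff v hv, neg_zero]
  · have hi' : i < n := Finset.mem_range.mp hi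
    have hwi : w e (i + 1) = (SignType.sign (c e (i + 1) - c e i) : ℝ) := by
      simp [w, hi'.ne]
    rw [hwi, sign_mul_cut_sub_cut]
    exact mul_le_abs_of_abs_le_one (hw'.bound e (i + 1) (by omega))

end MetricGraph

/-! ### Integration over the levels for step functions. -/

theorem measurable_cut_left (y : ℝ) : Measurable fun t => cut t y :=
  Measurable.ite measurableSet_Iio measurable_const measurable_const

/-- As a function of t the cut equals 1 on a whole half-line; subtracting the cut of 0 leaves a
signed indicator of a bounded interval, which is integrable. -/
theorem cut_sub_cut_zero (t y : ℝ) :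
    cut t y - cut t 0 = (Ico 0 y).indicator 1 t - (Ico y 0).indicator 1 t := by
  simp only [cut, indicator, mem_Ico, Pi.one_apply]
  split_ifs <;> grind

theorem integrable_cut_sub (y : ℝ) : Integrable fun t => cut t y - cut t 0 := by
  simp only [cut_sub_cut_zero]
  exact ((integrable_indicator_iff measurableSet_Ico).mpr (integrableOn_const (by simp))).sub
    ((integrable_indicator_iff measurableSet_Ico).mpr (integrableOn_const (by simp)))

theorem integral_cut_sub (y : ℝ) : ∫ t, (cut t y - cut t 0) = y := by
  simp only [cut_sub_cut_zero]
  rw [integral_sub ((integrable_indicator_iff measurableSet_Ico).mpr (integrableOn_const (by simp)))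
    ((integrable_indicator_iff measurableSet_Ico).mpr (integrableOn_const (by simp))),
    integral_indicator_one measurableSet_Ico, integral_indicator_one measurableSet_Ico]
  simp only [Measure.real, Real.volume_Ico, ENNReal.toReal_ofReal']
  rcases le_total 0 y with h | h
  · rw [max_eq_left (by linarith), max_eq_right (by linarith)]
    ring
  · rw [max_eq_right (by linarith), max_eq_left (by linarith)]
    ring

namespace MetricGraph

variable {V E : Type*} [Fintype E]

/-- Constants are invisible to the pairing because the field differences telescope. This permits the
normalization by `cut t 0` under the integral. -/
theorem stepPairing_sub_const (Γ : MetricGraph V E) (n : ℕ) (c : E → ℕ → ℝ) (u : V → ℝ)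
    (w : E → ℕ → ℝ) (k : ℝ) :
    Γ.stepPairing n (fun e i => c e i - k) (fun v => u v - k) w = Γ.stepPairing n c u w := by
  refine Finset.sum_congr rfl fun e _ => ?_
  have h : ∑ i ∈ Finset.range n, (c e i - k) * (w e (i + 1) - w e i)
      = ∑ i ∈ Finset.range n, c e i * (w e (i + 1) - w e i) - k * (w e n - w e 0) := by
    rw [← Finset.sum_range_sub, Finset.mul_sum, ← Finset.sum_sub_distrib]
    exact Finset.sum_congr rfl fun i _ => by ring
  rw [h]
  ring

theorem measurable_stepPairing_cut (Γ : MetricGraph V E) (n : ℕ) (c : E → ℕ → ℝ) (u : V → ℝ)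
    (w : E → ℕ → ℝ) :
    Measurable fun t => Γ.stepPairing n (fun e i => cut t (c e i)) (fun v => cut t (u v)) w := by
  unfold stepPairing
  have := measurable_cut_left
  fun_prop

/-- The coarea formula for step functions and a fixed discrete field. -/
theorem lintegral_stepPairing_cut (Γ : MetricGraph V E) (n : ℕ) (c : E → ℕ → ℝ) (u : V → ℝ)
    (w : E → ℕ → ℝ)
    (h0 : ∀ t, 0 ≤ Γ.stepPairing n (fun e i => cut t (c e i)) (fun v => cut t (u v)) w) :
    ∫⁻ t, ENNReal.ofReal (Γ.stepPairing n (fun e i => cut t (c e i)) (fun v => cut t (u v)) w)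
      = ENNReal.ofReal (Γ.stepPairing n c u w) := by
  have heq : ∀ t, Γ.stepPairing n (fun e i => cut t (c e i)) (fun v => cut t (u v)) w
      = Γ.stepPairing n (fun e i => cut t (c e i) - cut t 0) (fun v => cut t (u v) - cut t 0) w :=
    fun t => (Γ.stepPairing_sub_const n _ _ w _).symm
  have hint : ∀ e, Integrable fun t => (cut t (u (Γ.tgt e)) - cut t 0) * w e n
      - (cut t (u (Γ.src e)) - cut t 0) * w e 0 := fun e =>
    ((integrable_cut_sub _).mul_const _).sub ((integrable_cut_sub _).mul_const _)
  have hint' : ∀ e, ∀ i ∈ Finset.range n,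
      Integrable fun t => (cut t (c e i) - cut t 0) * (w e (i + 1) - w e i) := fun e i _ =>
    (integrable_cut_sub _).mul_const _
  have hint'' : ∀ e, Integrable fun t => ∑ i ∈ Finset.range n,
      (cut t (c e i) - cut t 0) * (w e (i + 1) - w e i) := fun e =>
    integrable_finsetSum _ (hint' e)
  have hint3 : ∀ e, Integrable fun t => (cut t (u (Γ.tgt e)) - cut t 0) * w e n
      - (cut t (u (Γ.src e)) - cut t 0) * w e 0 - ∑ i ∈ Finset.range n,
      (cut t (c e i) - cut t 0) * (w e (i + 1) - w e i) := fun e => (hint e).sub (hint'' e)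
  rw [← ofReal_integral_eq_lintegral_ofReal]
  · simp only [heq]
    unfold stepPairing
    beta_reduce
    rw [integral_finsetSum (μ := volume) _ fun e _ => hint3 e]
    congr 1
    refine Finset.sum_congr rfl fun e _ => ?_
    rw [integral_sub (hint e) (hint'' e), integral_finsetSum _ (hint' e),
      integral_sub ((integrable_cut_sub _).mul_const _) ((integrable_cut_sub _).mul_const _)]
    simp only [integral_mul_const, integral_cut_sub]
  · simp only [heq]
    exact integrable_finsetSum _ fun e _ => hint3 e
  · exact Filter.Eventually.of_forall h0

end MetricGraph

/-! ### Smooth interpolation of discrete fields and weighted cell averages. -/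

/-- The `C¹` interpolation of the values `w 0, …, w n` at the ends of the `n` cells of `[0, ℓ]`. -/
noncomputable def smoothField (ℓ : ℝ) (n : ℕ) (w : ℕ → ℝ) (x : ℝ) : ℝ :=
  w 0 + ∑ i ∈ Finset.range n, (w (i + 1) - w i) * Real.smoothTransition (n / ℓ * x - i)

/-- The averaging weight of the `i`-th of the `n` cells of `[0, ℓ]`. -/
noncomputable def cellWeight (ℓ : ℝ) (n i : ℕ) (x : ℝ) : ℝ :=
  n / ℓ * deriv Real.smoothTransition (n / ℓ * x - i)

theorem contDiff_smoothField (ℓ : ℝ) (n : ℕ) (w : ℕ → ℝ) : ContDiff ℝ 1 (smoothField ℓ n w) := by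
  refine contDiff_const.add (ContDiff.sum fun i _ => contDiff_const.mul ?_)
  exact (Real.smoothTransition.contDiff (n := 1)).comp ((contDiff_const.mul contDiff_id).sub contDiff_const)

theorem hasDerivAt_smoothTransition_comp (ℓ : ℝ) (n i : ℕ) (x : ℝ) :
    HasDerivAt (fun x => Real.smoothTransition (n / ℓ * x - i)) (cellWeight ℓ n i x) x := by
  have h1 : HasDerivAt (fun x : ℝ => n / ℓ * x - i) (n / ℓ) x := by
    simpa using ((hasDerivAt_id x).const_mul (n / ℓ : ℝ)).sub_const (i : ℝ)
  have h2 : HasDerivAt Real.smoothTransition (deriv Real.smoothTransition (n / ℓ * x - i))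
      (n / ℓ * x - i) :=
    ((Real.smoothTransition.contDiff (n := 1)).differentiable (by norm_num) _).hasDerivAt
  have := h2.comp x h1
  rwa [mul_comm] at this

theorem deriv_smoothField (ℓ : ℝ) (n : ℕ) (w : ℕ → ℝ) (x : ℝ) :
    deriv (smoothField ℓ n w) x
      = ∑ i ∈ Finset.range n, (w (i + 1) - w i) * cellWeight ℓ n i x := by
  refine HasDerivAt.deriv ?_
  refine HasDerivAt.const_add _ (HasDerivAt.fun_sum fun i _ => ?_)
  exact (hasDerivAt_smoothTransition_comp ℓ n i x).const_mul _

theorem smoothField_zero (ℓ : ℝ) (n : ℕ) (w : ℕ → ℝ) : smoothField ℓ n w 0 = w 0 := by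
  unfold smoothField
  rw [Finset.sum_eq_zero, add_zero]
  intro i _
  rw [Real.smoothTransition.zero_of_nonpos (by simp), mul_zero]

theorem smoothField_length {ℓ : ℝ} (hℓ : 0 < ℓ) (n : ℕ) (w : ℕ → ℝ) :
    smoothField ℓ n w ℓ = w n := by
  unfold smoothField
  rw [Finset.sum_congr rfl (g := fun i => w (i + 1) - w i), Finset.sum_range_sub]
  · ring
  · intro i hi
    have : (i : ℝ) + 1 ≤ n := by exact_mod_cast Finset.mem_range.mp hi
    rw [Real.smoothTransition.one_of_one_le, mul_one]
    rw [div_mul_cancel₀ _ hℓ.ne']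
    linarith

/-- For s in the k-th unit interval the earlier transitions equal 1 and the later ones 0, so the
value is a convex combination of w k and w (k + 1). -/
theorem abs_interpolation_le_one (n : ℕ) (w : ℕ → ℝ) (hw : ∀ i ≤ n, |w i| ≤ 1) (s : ℝ) :
    |w 0 + ∑ i ∈ Finset.range n, (w (i + 1) - w i) * Real.smoothTransition (s - i)| ≤ 1 := by
  induction n with
  | zero => simpa using hw 0 le_rfl
  | succ n ih =>
    rw [Finset.sum_range_succ]
    rcases le_total s n with h | h
    · rw [Real.smoothTransition.zero_of_nonpos (x := s - n) (by linarith), mul_zero, add_zero]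
      exact ih fun i hi => hw i (by omega)
    · rw [Finset.sum_congr rfl (g := fun i => w (i + 1) - w i), Finset.sum_range_sub]
      · have h0 := Real.smoothTransition.nonneg (s - n)
        have h1 := Real.smoothTransition.le_one (s - n)
        have ha := abs_le.mp (hw n (by omega))
        have hb := abs_le.mp (hw (n + 1) le_rfl)
        rw [abs_le]
        constructor <;> nlinarith
      · intro i hi
        have : (i : ℝ) + 1 ≤ n := by exact_mod_cast Finset.mem_range.mp hi
        rw [Real.smoothTransition.one_of_one_le (by linarith), mul_one]

theorem abs_smoothField_le_one (ℓ : ℝ) (n : ℕ) (w : ℕ → ℝ) (hw : ∀ i ≤ n, |w i| ≤ 1) (x : ℝ) :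
    |smoothField ℓ n w x| ≤ 1 :=
  abs_interpolation_le_one n w hw _

/-- Every such point is a global minimum. -/
theorem deriv_smoothTransition_of_nonpos {y : ℝ} (hy : y ≤ 0) :
    deriv Real.smoothTransition y = 0 :=
  IsLocalMin.deriv_eq_zero <| Filter.Eventually.of_forall fun z => by
    rw [Real.smoothTransition.zero_of_nonpos hy]
    exact Real.smoothTransition.nonneg z

theorem deriv_smoothTransition_of_one_le {y : ℝ} (hy : 1 ≤ y) :
    deriv Real.smoothTransition y = 0 :=
  IsLocalMax.deriv_eq_zero <| Filter.Eventually.of_forall fun z => by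
    rw [Real.smoothTransition.one_of_one_le hy]
    exact Real.smoothTransition.le_one z

theorem continuous_deriv_smoothTransition : Continuous (deriv Real.smoothTransition) :=
  (Real.smoothTransition.contDiff (n := 1)).continuous_deriv le_rfl

theorem exists_abs_deriv_smoothTransition_le :
    ∃ M, 0 ≤ M ∧ ∀ y, |deriv Real.smoothTransition y| ≤ M := by
  obtain ⟨M, hM⟩ := isCompact_Icc.exists_bound_of_continuousOn (s := Icc (0 : ℝ) 1)
    continuous_deriv_smoothTransition.continuousOn
  have hM0 : 0 ≤ M := (norm_nonneg _).trans (hM 0 (by simp))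
  refine ⟨M, hM0, fun y => ?_⟩
  by_cases h0 : y ≤ 0
  · simpa [deriv_smoothTransition_of_nonpos h0]
  by_cases h1 : 1 ≤ y
  · simpa [deriv_smoothTransition_of_one_le h1]
  exact hM y ⟨by linarith, by linarith⟩

theorem continuous_cellWeight (ℓ : ℝ) (n i : ℕ) : Continuous (cellWeight ℓ n i) :=
  continuous_const.mul (continuous_deriv_smoothTransition.comp
    ((continuous_const.mul continuous_id).sub continuous_const))

theorem integral_cellWeight {ℓ : ℝ} (hℓ : 0 < ℓ) {n i : ℕ} (hi : i < n) :
    ∫ x in (0 : ℝ)..ℓ, cellWeight ℓ n i x = 1 := by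
  rw [intervalIntegral.integral_eq_sub_of_hasDerivAt
    (fun x _ => hasDerivAt_smoothTransition_comp ℓ n i x)
    ((continuous_cellWeight ℓ n i).intervalIntegrable _ _)]
  have : (i : ℝ) + 1 ≤ n := by exact_mod_cast hi
  rw [Real.smoothTransition.one_of_one_le, Real.smoothTransition.zero_of_nonpos (by simp), sub_zero]
  rw [div_mul_cancel₀ _ hℓ.ne']
  linarith

namespace MetricGraph

variable {V E : Type*}

instance [Finite E] (Γ : MetricGraph V E) : IsFiniteMeasure Γ.lengthMeasure := by
  have := Fintype.ofFinite E
  unfold lengthMeasure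
  rw [Measure.sum_fintype]
  infer_instance

theorem map_coord_le (Γ : MetricGraph V E) (e : E) :
    (volume.restrict (Ioo 0 (Γ.len e))).map (Γ.coord e) ≤ Γ.lengthMeasure :=
  Measure.le_sum (fun e => (volume.restrict (Ioo 0 (Γ.len e))).map (Γ.coord e)) e

theorem integrableOn_coord (Γ : MetricGraph V E) {u : Γ.Point → ℝ}
    (hu : Integrable u Γ.lengthMeasure) (e : E) :
    IntegrableOn (fun x => u (Γ.coord e x)) (Ioo 0 (Γ.len e)) :=
  (hu.mono_measure (Γ.map_coord_le e)).comp_measurable (Γ.measurable_coord e)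

theorem intervalIntegrable_coord (Γ : MetricGraph V E) {u : Γ.Point → ℝ}
    (hu : Integrable u Γ.lengthMeasure) (e : E) :
    IntervalIntegrable (fun x => u (Γ.coord e x)) volume 0 (Γ.len e) :=
  (intervalIntegrable_iff_integrableOn_Ioo_of_le (Γ.len_pos e).le).mpr (Γ.integrableOn_coord hu e)

/-- The weighted average of `u` over the `i`-th of the `n` cells of the edge `e`. -/
noncomputable def cellAverage (Γ : MetricGraph V E) (u : Γ.Point → ℝ) (n : ℕ) (e : E) (i : ℕ) : ℝ :=
  ∫ x in (0 : ℝ)..Γ.len e, u (Γ.coord e x) * cellWeight (Γ.len e) n i x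

variable [Fintype E]

theorem IsDiscreteField.isTestField_smoothField {Γ : MetricGraph V E} {W : Set V} {n : ℕ}
    {w : E → ℕ → ℝ} (hw : Γ.IsDiscreteField W n w) :
    Γ.IsTestField W fun e => smoothField (Γ.len e) n (w e) where
  contDiff e := contDiff_smoothField _ _ _
  bound e x _ := abs_smoothField_le_one _ _ _ (hw.bound e) x
  kirchhoff v hv := by
    simp only [flux, smoothField_zero, smoothField_length (Γ.len_pos _)]
    exact hw.kirchhoff v hv

/-- The derivative of the interpolation is a combination of the cell weights, so the pairing sees u
only through its cell averages. The identity is exact, without an error term. -/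
theorem derivPairing_smoothField (Γ : MetricGraph V E) {u : Γ.Point → ℝ}
    (hu : Integrable u Γ.lengthMeasure) (n : ℕ) (w : E → ℕ → ℝ) :
    Γ.derivPairing u (fun e => smoothField (Γ.len e) n (w e))
      = Γ.stepPairing n (Γ.cellAverage u n) (fun v => u (.vertex v)) w := by
  refine Finset.sum_congr rfl fun e _ => ?_
  beta_reduce
  rw [smoothField_zero, smoothField_length (Γ.len_pos e)]
  congr 1
  simp only [deriv_smoothField, Finset.mul_sum]
  rw [intervalIntegral.integral_finsetSum]
  · refine Finset.sum_congr rfl fun i _ => ?_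
    rw [cellAverage, ← intervalIntegral.integral_mul_const]
    congr 1
    ext x
    ring
  · intro i _
    exact (Γ.intervalIntegrable_coord hu e).mul_continuousOn
      (continuous_const.mul (continuous_cellWeight _ _ _)).continuousOn

end MetricGraph

/-! ### Convergence of the cell averages and of step integrals. -/

open Filter Topology Metric in
/-- The weighted averages of `f` over the cells that contain `x` converge to `f x` for a.e. `x`. -/
theorem ae_tendsto_integral_mul_cellWeight {f : ℝ → ℝ} {ℓ : ℝ} (hℓ : 0 < ℓ)
    (hf : IntegrableOn f (Ioo 0 ℓ)) :
    ∀ᵐ x, x ∈ Ioo 0 ℓ → Tendsto (fun n : ℕ => ∫ y in (0 : ℝ)..ℓ, f y *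
      cellWeight ℓ (n + 1) ⌊((n + 1 : ℕ) : ℝ) / ℓ * x⌋₊ y) atTop (𝓝 (f x)) := by
  obtain ⟨M, hM0, hM⟩ := exists_abs_deriv_smoothTransition_le
  set F : ℝ → ℝ := (Ioo 0 ℓ).indicator f with hF
  have hFi : Integrable F := (integrable_indicator_iff measurableSet_Ioo).mpr hf
  -- The closed ball is the i-th cell. The weight has integral 1, vanishes off the cell, and is at
  -- most M divided by the length of the cell.
  have bound : ∀ (N i : ℕ), i < N → ∀ x, |(∫ y in (0 : ℝ)..ℓ, f y * cellWeight ℓ N i y) - F x|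
      ≤ M * ⨍ y in closedBall ((i + 1 / 2) * (ℓ / N)) (ℓ / N / 2), ‖F y - F x‖ := by
    intro N i hi x
    have hN : (0 : ℝ) < N := by exact_mod_cast (Nat.zero_le i).trans_lt hi
    set B := closedBall ((i + 1 / 2) * (ℓ / N)) (ℓ / N / 2) with hB
    have hw : ∀ y, y ∉ B → cellWeight ℓ N i y = 0 := by
      intro y hy
      rw [hB, Real.closedBall_eq_Icc, mem_Icc, not_and_or, not_le, not_le] at hy
      unfold cellWeight
      rcases hy with hy | hy
      · rw [deriv_smoothTransition_of_nonpos, mul_zero]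
        have h1 : y < i * (ℓ / N) := by linarith
        have h2 := mul_lt_mul_of_pos_left h1 (div_pos hN hℓ)
        have h3 : (N : ℝ) / ℓ * (i * (ℓ / N)) = i := by field_simp
        linarith
      · rw [deriv_smoothTransition_of_one_le, mul_zero]
        have h1 : (i + 1) * (ℓ / N) < y := by linarith
        have h2 := mul_lt_mul_of_pos_left h1 (div_pos hN hℓ)
        have h3 : (N : ℝ) / ℓ * ((i + 1) * (ℓ / N)) = i + 1 := by field_simp
        linarith
    have hfF : ∫ y in (0 : ℝ)..ℓ, f y * cellWeight ℓ N i y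
        = ∫ y in (0 : ℝ)..ℓ, F y * cellWeight ℓ N i y := by
      rw [intervalIntegral.integral_of_le hℓ.le, intervalIntegral.integral_of_le hℓ.le,
        integral_Ioc_eq_integral_Ioo, integral_Ioc_eq_integral_Ioo]
      refine setIntegral_congr_fun measurableSet_Ioo fun y hy => ?_
      simp only [hF, indicator_of_mem hy]
    have hFii : IntervalIntegrable F volume 0 ℓ := hFi.intervalIntegrable
    have hcw := continuous_cellWeight ℓ N i
    have hdiff : (∫ y in (0 : ℝ)..ℓ, f y * cellWeight ℓ N i y) - F x
        = ∫ y in (0 : ℝ)..ℓ, (F y - F x) * cellWeight ℓ N i y := by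
      simp only [sub_mul]
      rw [intervalIntegral.integral_sub (hFii.mul_continuousOn hcw.continuousOn)
        ((hcw.intervalIntegrable _ _).const_mul _), intervalIntegral.integral_const_mul,
        integral_cellWeight hℓ hi, mul_one, hfF]
    set g : ℝ → ℝ := B.indicator fun y => ‖F y - F x‖ * (N / ℓ * M) with hg
    have hBfin : volume B ≠ ∞ := measure_closedBall_lt_top.ne
    have hgi : Integrable g := by
      rw [hg, integrable_indicator_iff measurableSet_closedBall]
      exact ((hFi.integrableOn.sub (integrableOn_const hBfin)).norm).mul_const _
    have hg0 : ∀ y, 0 ≤ g y := fun y => indicator_nonneg (fun y _ => by positivity) y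
    have hle : ∀ y, ‖(F y - F x) * cellWeight ℓ N i y‖ ≤ g y := by
      intro y
      by_cases hy : y ∈ B
      · rw [hg, indicator_of_mem hy, norm_mul]
        refine mul_le_mul_of_nonneg_left ?_ (norm_nonneg _)
        unfold cellWeight
        rw [Real.norm_eq_abs, abs_mul, abs_of_pos (div_pos hN hℓ)]
        exact mul_le_mul_of_nonneg_left (hM _) (div_pos hN hℓ).le
      · rw [hw y hy, mul_zero, norm_zero]
        exact hg0 y
    have hvol : volume.real B = ℓ / N := by
      rw [hB, Real.volume_real_closedBall (by positivity)]
      ring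
    calc |(∫ y in (0 : ℝ)..ℓ, f y * cellWeight ℓ N i y) - F x|
        ≤ ∫ y in (0 : ℝ)..ℓ, g y := by
          rw [hdiff]
          exact intervalIntegral.norm_integral_le_of_norm_le hℓ.le
            (Eventually.of_forall fun y _ => hle y) hgi.intervalIntegrable
      _ ≤ ∫ y, g y := by
          rw [intervalIntegral.integral_of_le hℓ.le]
          exact setIntegral_le_integral hgi (Eventually.of_forall hg0)
      _ = M * ⨍ y in B, ‖F y - F x‖ := by
          rw [hg, integral_indicator measurableSet_closedBall, integral_mul_const, setAverage_eq,
            hvol, smul_eq_mul, inv_div]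
          ring
  -- The cells contain x but are not centred at it, so the Lebesgue differentiation theorem is
  -- needed with moving centres; membership of x in the cell itself is the case of dilation factor
  -- 1.
  filter_upwards [IsUnifLocDoublingMeasure.ae_tendsto_average_norm_sub volume
    hFi.locallyIntegrable 1] with x hx hxm
  have hFx : F x = f x := by rw [hF, indicator_of_mem hxm]
  have hpos : ∀ n : ℕ, (0 : ℝ) < ((n + 1 : ℕ) : ℝ) := fun n => by positivity
  have hδ : Tendsto (fun n : ℕ => ℓ / ((n + 1 : ℕ) : ℝ) / 2) atTop (𝓝[>] 0) := by
    refine tendsto_nhdsWithin_iff.mpr ⟨?_, Eventually.of_forall fun n => ?_⟩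
    · have h1 : Tendsto (fun n : ℕ => ℓ / (n : ℝ) / 2) atTop (𝓝 (0 / 2)) :=
        (tendsto_const_div_atTop_nhds_zero_nat ℓ).div_const 2
      rw [zero_div] at h1
      exact h1.comp (tendsto_add_atTop_nat 1)
    · have := hpos n
      exact div_pos (div_pos hℓ this) two_pos
  have hfl : ∀ n : ℕ, ⌊((n + 1 : ℕ) : ℝ) / ℓ * x⌋₊ < n + 1 := fun n => by
    rw [Nat.floor_lt (mul_nonneg (div_pos (hpos n) hℓ).le hxm.1.le), div_mul_eq_mul_div,
      div_lt_iff₀ hℓ]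
    exact mul_lt_mul_of_pos_left hxm.2 (hpos n)
  have hxB : ∀ n : ℕ, x ∈ closedBall ((⌊((n + 1 : ℕ) : ℝ) / ℓ * x⌋₊ + 1 / 2)
      * (ℓ / ((n + 1 : ℕ) : ℝ))) (1 * (ℓ / ((n + 1 : ℕ) : ℝ) / 2)) := fun n => by
    have h1 := Nat.floor_le (mul_nonneg (div_pos (hpos n) hℓ).le hxm.1.le)
    have h2 := (Nat.lt_floor_add_one (((n + 1 : ℕ) : ℝ) / ℓ * x)).le
    have h3 : (((n + 1 : ℕ) : ℝ) / ℓ * x) * (ℓ / ((n + 1 : ℕ) : ℝ)) = x := by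
      have := (hpos n).ne'
      field_simp
    have hq := (div_pos hℓ (hpos n)).le
    have h4 := mul_le_mul_of_nonneg_right h1 hq
    have h5 := mul_le_mul_of_nonneg_right h2 hq
    rw [h3] at h4 h5
    rw [Real.closedBall_eq_Icc]
    constructor <;> linarith
  have hlim := hx (fun n : ℕ => ((⌊((n + 1 : ℕ) : ℝ) / ℓ * x⌋₊ : ℝ) + 1 / 2)
      * (ℓ / ((n + 1 : ℕ) : ℝ))) _ hδ (Eventually.of_forall hxB)
  have hlim' := hlim.const_mul M
  rw [mul_zero] at hlim'
  rw [← hFx, tendsto_iff_dist_tendsto_zero]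
  exact squeeze_zero (fun _ => dist_nonneg) (fun n => bound (n + 1) _ (hfl n) x) hlim'

/-- The integral of a step function on `n` cells against a derivative. -/
theorem sum_mul_sub_eq_integral_floor {ℓ : ℝ} (hℓ : 0 < ℓ) {n : ℕ} (hn : 0 < n) (b : ℕ → ℝ)
    {z : ℝ → ℝ} (hz : ContDiff ℝ 1 z) :
    ∑ i ∈ Finset.range n, b i * (z (((i + 1 : ℕ) : ℝ) / n * ℓ) - z ((i : ℝ) / n * ℓ))
      = ∫ x in (0 : ℝ)..ℓ, b ⌊(n : ℝ) / ℓ * x⌋₊ * deriv z x := by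
  have hn' : (0 : ℝ) < n := by exact_mod_cast hn
  have hz' : Continuous (deriv z) := hz.continuous_deriv le_rfl
  have hle : ∀ i : ℕ, (i : ℝ) / n * ℓ ≤ ((i + 1 : ℕ) : ℝ) / n * ℓ := fun i => by
    gcongr
    exact i.le_succ
  have hcongr : ∀ i : ℕ, ∀ x ∈ Ioo ((i : ℝ) / n * ℓ) (((i + 1 : ℕ) : ℝ) / n * ℓ),
      b i * deriv z x = b ⌊(n : ℝ) / ℓ * x⌋₊ * deriv z x := fun i x hx => by
    have h1 := mul_lt_mul_of_pos_left hx.1 (div_pos hn' hℓ)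
    have h2 := mul_lt_mul_of_pos_left hx.2 (div_pos hn' hℓ)
    have h3 : ∀ k : ℕ, (n : ℝ) / ℓ * ((k : ℝ) / n * ℓ) = k := fun k => by field_simp
    rw [h3] at h1 h2
    have : ⌊(n : ℝ) / ℓ * x⌋₊ = i := by
      rw [Nat.floor_eq_iff ((Nat.cast_nonneg i).trans h1.le)]
      exact ⟨h1.le, by exact_mod_cast h2⟩
    rw [this]
  have hint : ∀ i : ℕ, IntervalIntegrable (fun x => b ⌊(n : ℝ) / ℓ * x⌋₊ * deriv z x) volume
      ((i : ℝ) / n * ℓ) (((i + 1 : ℕ) : ℝ) / n * ℓ) := fun i => by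
    rw [intervalIntegrable_iff_integrableOn_Ioo_of_le (hle i)]
    refine IntegrableOn.congr_fun (f := fun x => b i * deriv z x) ?_ (hcongr i) measurableSet_Ioo
    rw [← intervalIntegrable_iff_integrableOn_Ioo_of_le (hle i)]
    exact (hz'.intervalIntegrable _ _).const_mul _
  have hsum := intervalIntegral.sum_integral_adjacent_intervals
    (a := fun i : ℕ => (i : ℝ) / n * ℓ) (n := n) fun i _ => hint i
  rw [div_self hn'.ne', one_mul] at hsum
  simp only [Nat.cast_zero, zero_div, zero_mul] at hsum
  rw [← hsum]
  refine Finset.sum_congr rfl fun i _ => ?_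
  rw [intervalIntegral.integral_of_le (hle i), integral_Ioc_eq_integral_Ioo,
    ← setIntegral_congr_fun measurableSet_Ioo (hcongr i), ← integral_Ioc_eq_integral_Ioo,
    ← intervalIntegral.integral_of_le (hle i), intervalIntegral.integral_const_mul,
    intervalIntegral.integral_deriv_eq_sub
      (fun x _ => (hz.differentiable (by norm_num)) x) (hz'.intervalIntegrable _ _)]

open Filter Topology in
theorem tendsto_cut {t y : ℝ} {f : ℕ → ℝ} (hf : Tendsto f atTop (𝓝 y)) (hy : y ≠ t) :
    Tendsto (fun n => cut t (f n)) atTop (𝓝 (cut t y)) := by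
  refine tendsto_const_nhds.congr' ?_
  rcases lt_or_gt_of_ne hy with h | h
  · filter_upwards [hf.eventually_lt_const h] with n hn
    rw [cut_of_le h.le, cut_of_le hn.le]
  · filter_upwards [hf.eventually_const_lt h] with n hn
    rw [cut_of_lt h, cut_of_lt hn]

/-! ### Lower semicontinuity and the coarea inequality. -/

namespace MetricGraph

variable {V E : Type*}

/-- Almost every level set of a function is negligible on every edge. -/
theorem ae_forall_coord_ne [Finite E] (Γ : MetricGraph V E) {u : Γ.Point → ℝ}
    (hu : Integrable u Γ.lengthMeasure) :
    ∀ᵐ t : ℝ, ∀ e, ∀ᵐ x, x ∈ Ioo 0 (Γ.len e) → u (Γ.coord e x) ≠ t := by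
  rw [ae_all_iff]
  intro e
  have hm : AEMeasurable (fun x => u (Γ.coord e x)) (volume.restrict (Ioo 0 (Γ.len e))) :=
    (Γ.integrableOn_coord hu e).aemeasurable
  -- Level sets for distinct levels are disjoint, so only countably many have positive measure.
  filter_upwards [(Measure.countable_meas_level_set_pos₀ hm.nullMeasurable).ae_notMem volume]
    with t ht
  rw [← ae_restrict_iff' measurableSet_Ioo, ae_iff]
  simpa using ht

variable [Fintype E]

open Filter Topology in
/-- Lower semicontinuity of the perimeter of superlevel sets along the step functions of cell
averages, whose perimeters are bounded by the pairings with the fields `w n`. -/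
theorem perimeter_le_liminf (Γ : MetricGraph V E) (W : Set V) {u : Γ.Point → ℝ}
    (hu : Integrable u Γ.lengthMeasure) (w : ℕ → E → ℕ → ℝ)
    (hw : ∀ n t w', Γ.IsDiscreteField W (n + 1) w' →
      Γ.stepPairing (n + 1) (fun e i => cut t (Γ.cellAverage u (n + 1) e i))
        (fun v => cut t (u (.vertex v))) w'
      ≤ Γ.stepPairing (n + 1) (fun e i => cut t (Γ.cellAverage u (n + 1) e i))
        (fun v => cut t (u (.vertex v))) (w n)) :
    ∀ᵐ t : ℝ, Γ.perimeter W {x | t < u x} ≤ liminf (fun n : ℕ => ENNReal.ofReal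
      (Γ.stepPairing (n + 1) (fun e i => cut t (Γ.cellAverage u (n + 1) e i))
        (fun v => cut t (u (.vertex v))) (w n))) atTop := by
  filter_upwards [Γ.ae_forall_coord_ne hu] with t ht
  refine iSup₂_le fun z hz => ?_
  -- Sampling z at the cell ends gives a discrete competitor. Its pairing with the cut averages
  -- tends to the pairing of z with the superlevel set, and by `hw` it never exceeds the pairing
  -- with `w n`.
  let w' : ℕ → E → ℕ → ℝ := fun n e i => z e ((i : ℝ) / ((n + 1 : ℕ) : ℝ) * Γ.len e)
  have hpos : ∀ n : ℕ, (0 : ℝ) < ((n + 1 : ℕ) : ℝ) := fun n => by positivity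
  have hw0 : ∀ n e, w' n e 0 = z e 0 := fun n e => by simp [w']
  have hwn : ∀ n e, w' n e (n + 1) = z e (Γ.len e) := fun n e => by
    simp only [w']
    rw [div_self (hpos n).ne', one_mul]
  have hw' : ∀ n, Γ.IsDiscreteField W (n + 1) (w' n) := fun n => by
    refine ⟨fun e i hi => hz.bound e _ ⟨?_, ?_⟩, fun v hv => ?_⟩
    · exact mul_nonneg (div_nonneg (Nat.cast_nonneg _) (Nat.cast_nonneg _)) (Γ.len_pos e).le
    · refine mul_le_of_le_one_left (Γ.len_pos e).le ?_
      rw [div_le_one (hpos n)]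
      exact_mod_cast hi
    · simp only [hw0, hwn]
      exact hz.kirchhoff v hv
  have hlim : Tendsto (fun n : ℕ => Γ.stepPairing (n + 1)
      (fun e i => cut t (Γ.cellAverage u (n + 1) e i)) (fun v => cut t (u (.vertex v))) (w' n))
      atTop (𝓝 (Γ.derivPairing ({x | t < u x}.indicator 1) z)) := by
    have hind : ∀ p, ({x | t < u x}.indicator 1 p : ℝ) = cut t (u p) := fun p => by
      simp [cut, indicator]
    unfold stepPairing derivPairing
    refine tendsto_finsetSum _ fun e _ => ?_
    simp only [hind, hw0, hwn]
    refine tendsto_const_nhds.sub ?_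
    have hz' : Continuous (deriv (z e)) := (hz.contDiff e).continuous_deriv le_rfl
    have heq : ∀ n : ℕ, ∑ i ∈ Finset.range (n + 1), cut t (Γ.cellAverage u (n + 1) e i)
          * (w' n e (i + 1) - w' n e i)
        = ∫ x in (0 : ℝ)..Γ.len e, cut t (Γ.cellAverage u (n + 1) e
            ⌊((n + 1 : ℕ) : ℝ) / Γ.len e * x⌋₊) * deriv (z e) x := fun n =>
      sum_mul_sub_eq_integral_floor (Γ.len_pos e) n.succ_pos
        (fun i => cut t (Γ.cellAverage u (n + 1) e i)) (hz.contDiff e)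
    simp only [heq]
    refine intervalIntegral.tendsto_integral_filter_of_dominated_convergence
      (fun x => |deriv (z e) x|) ?_ ?_ (hz'.abs.intervalIntegrable _ _) ?_
    · refine Eventually.of_forall fun n => Measurable.aestronglyMeasurable ?_
      refine Measurable.mul ?_ hz'.measurable
      exact (measurable_from_nat (f := fun i => cut t (Γ.cellAverage u (n + 1) e i))).comp
        (Nat.measurable_floor.comp (measurable_const.mul measurable_id))
    · refine Eventually.of_forall fun n => Eventually.of_forall fun x _ => ?_
      rw [norm_mul, Real.norm_eq_abs, Real.norm_eq_abs, abs_of_nonneg (cut_nonneg _ _)]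
      exact mul_le_of_le_one_left (abs_nonneg _) (cut_le_one _ _)
    · rw [uIoc_of_le (Γ.len_pos e).le]
      filter_upwards [ht e, ae_tendsto_integral_mul_cellWeight (Γ.len_pos e)
        (Γ.integrableOn_coord hu e), (countable_singleton (Γ.len e)).ae_notMem volume]
        with x h1 h2 h3 hx
      -- The averages tend to u at x, which differs from t, and the cut at level t is locally
      -- constant away from t.
      have hx' : x ∈ Ioo 0 (Γ.len e) := ⟨hx.1, lt_of_le_of_ne hx.2 h3⟩
      exact (tendsto_cut (h2 hx') (h1 hx')).mul_const _
  rw [← (ENNReal.tendsto_ofReal hlim).liminf_eq]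
  exact liminf_le_liminf (Eventually.of_forall fun n => ENNReal.ofReal_le_ofReal (hw n t _ (hw' n)))

open Filter in
/-- One half of the coarea formula: the perimeters of the superlevel sets have a measurable
majorant whose integral is at most the total variation. -/
theorem exists_measurable_perimeter_le [Finite V] (Γ : MetricGraph V E) (W : Set V)
    {u : Γ.Point → ℝ} (hu : Integrable u Γ.lengthMeasure) :
    ∃ g : ℝ → ℝ≥0∞, Measurable g ∧ (∀ᵐ t, Γ.perimeter W {x | t < u x} ≤ g t) ∧
      ∫⁻ t, g t ≤ Γ.totalVariation W u := by
  choose w hw hmax using fun n : ℕ =>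
    Γ.exists_calibration W n (Γ.cellAverage u (n + 1)) (fun v => u (.vertex v))
  have hmeas : ∀ n : ℕ, Measurable fun t => ENNReal.ofReal (Γ.stepPairing (n + 1)
      (fun e i => cut t (Γ.cellAverage u (n + 1) e i)) (fun v => cut t (u (.vertex v))) (w n)) :=
    fun n => (Γ.measurable_stepPairing_cut _ _ _ _).ennreal_ofReal
  refine ⟨_, Measurable.liminf hmeas, Γ.perimeter_le_liminf W hu w hmax, ?_⟩
  -- Fatou's lemma; it remains to bound each integral by the total variation of u.
  refine (lintegral_liminf_le hmeas).trans ?_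
  refine (liminf_le_liminf (v := fun _ => Γ.totalVariation W u)
    (Eventually.of_forall fun n => ?_)).trans (liminf_const _).le
  -- Comparison with the zero field shows that the extremal pairings are nonnegative, as
  -- `lintegral_stepPairing_cut` requires.
  have hzero : Γ.IsDiscreteField W (n + 1) 0 := ⟨by simp, by simp⟩
  rw [lintegral_stepPairing_cut, ← Γ.derivPairing_smoothField hu]
  · exact le_iSup₂_of_le _ (hw n).isTestField_smoothField le_rfl
  · intro t
    refine le_trans (le_of_eq ?_) (hmax n t 0 hzero)
    simp [stepPairing]

end MetricGraph

/-! ### Layer-cake formula, complements and the Cheeger inequality. -/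

namespace MetricGraph

variable {V E : Type*}

/-- The length of the superlevel set for a positive and of the sublevel set for a negative level. -/
noncomputable def levelLength (Γ : MetricGraph V E) (u : Γ.Point → ℝ) (t : ℝ) : ℝ≥0∞ :=
  if 0 < t then Γ.lengthMeasure {x | t < u x} else Γ.lengthMeasure {x | u x ≤ t}

/-- Layer-cake formula for the positive and negative parts of u. The strict version for the former
and the non-strict one for the latter make the sublevel sets exact complements of superlevel sets.
-/
theorem lintegral_levelLength (Γ : MetricGraph V E) {u : Γ.Point → ℝ}
    (hu : Integrable u Γ.lengthMeasure) :
    ∫⁻ t, Γ.levelLength u t = eLpNorm u 1 Γ.lengthMeasure := by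
  have hm := hu.aemeasurable
  have hmp : AEMeasurable (fun x => max (u x) 0) Γ.lengthMeasure := hm.max aemeasurable_const
  have hmn : AEMeasurable (fun x => max (-u x) 0) Γ.lengthMeasure := hm.neg.max aemeasurable_const
  have hsplit : ∀ x, ‖u x‖ₑ = ENNReal.ofReal (max (u x) 0) + ENNReal.ofReal (max (-u x) 0) := by
    intro x
    rw [← ENNReal.ofReal_add (le_max_right _ _) (le_max_right _ _), ← ofReal_norm,
      Real.norm_eq_abs, max_zero_add_max_neg_zero_eq_abs_self]
  rw [eLpNorm_one_eq_lintegral_enorm]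
  simp only [hsplit]
  rw [lintegral_add_left' hmp.ennreal_ofReal,
    lintegral_eq_lintegral_meas_lt (f := fun x => max (u x) 0) _ (.of_forall fun x =>
      le_max_right (u x) 0) hmp,
    lintegral_eq_lintegral_meas_le (f := fun x => max (-u x) 0) _ (.of_forall fun x =>
      le_max_right (-u x) 0) hmn,
    ← lintegral_add_compl _ (measurableSet_Ioi (a := (0 : ℝ))), compl_Ioi,
    setLIntegral_congr Iio_ae_eq_Iic.symm,
    ← (Measure.measurePreserving_neg (volume : Measure ℝ)).setLIntegral_comp_preimage_emb
      (MeasurableEquiv.neg ℝ).measurableEmbedding _ (Iio 0)]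
  congr 1
  · refine setLIntegral_congr_fun measurableSet_Ioi fun t (ht : 0 < t) => ?_
    simp [levelLength, ht, ht.not_gt]
  · have : (Neg.neg ⁻¹' Iio 0 : Set ℝ) = Ioi 0 := by
      ext t
      simp
    rw [this]
    refine setLIntegral_congr_fun measurableSet_Ioi fun t (ht : 0 < t) => ?_
    simp [levelLength, ht.le, ht.not_ge, le_neg]

theorem eLpNorm_indicator_one [Finite E] (Γ : MetricGraph V E) {D : Set Γ.Point}
    (hD : NullMeasurableSet D Γ.lengthMeasure) :
    eLpNorm (D.indicator (1 : Γ.Point → ℝ)) 1 Γ.lengthMeasure = Γ.lengthMeasure D := by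
  rw [eLpNorm_one_eq_lintegral_enorm, ← lintegral_indicator_one₀ hD]
  refine lintegral_congr fun x => ?_
  by_cases hx : x ∈ D <;> simp [hx]

theorem integrable_indicator_one [Finite E] (Γ : MetricGraph V E) {D : Set Γ.Point}
    (hD : NullMeasurableSet D Γ.lengthMeasure) :
    Integrable (D.indicator (1 : Γ.Point → ℝ)) Γ.lengthMeasure :=
  (integrable_const (1 : ℝ)).indicator₀ hD

theorem coord_of_mem (Γ : MetricGraph V E) {e : E} {x : ℝ} (hx : x ∈ Ioo 0 (Γ.len e)) :
    Γ.coord e x = .inner e x hx :=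
  dif_pos hx

theorem exists_coord_eq_vertex (Γ : MetricGraph V E) {e : E} {x : ℝ}
    (hx : x ∉ Ioo 0 (Γ.len e)) : ∃ v, Γ.coord e x = .vertex v := by
  unfold coord
  rw [dif_neg hx]
  split_ifs
  · exact ⟨_, rfl⟩
  · exact ⟨_, rfl⟩

/-- The set of vertices is measurable and has length zero. -/
theorem lengthMeasure_range_vertex (Γ : MetricGraph V E) :
    Γ.lengthMeasure (range Point.vertex) = 0 ∧
      MeasurableSet (range (Point.vertex : V → Γ.Point)) := by
  have hpre : ∀ e, Γ.coord e ⁻¹' range Point.vertex = (Ioo 0 (Γ.len e))ᶜ := fun e => by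
    ext x
    by_cases hx : x ∈ Ioo 0 (Γ.len e)
    · rw [mem_preimage, Γ.coord_of_mem hx]
      simpa using hx
    · obtain ⟨v, hv⟩ := Γ.exists_coord_eq_vertex hx
      rw [mem_preimage, hv]
      exact iff_of_true (mem_range_self v) hx
  have hmeas : MeasurableSet (range (Point.vertex : V → Γ.Point)) :=
    MeasurableSpace.measurableSet_iInf.mpr fun e =>
      show MeasurableSet (Γ.coord e ⁻¹' _) by
        rw [hpre]
        exact measurableSet_Ioo.compl
  refine ⟨?_, hmeas⟩
  rw [lengthMeasure, Measure.sum_apply _ hmeas, ENNReal.tsum_eq_zero]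
  intro e
  rw [Measure.map_apply (Γ.measurable_coord e) hmeas, hpre,
    Measure.restrict_apply measurableSet_Ioo.compl, compl_inter_self, measure_empty]

theorem nullMeasurableSet_lt (Γ : MetricGraph V E) {u : Γ.Point → ℝ}
    (hu : Integrable u Γ.lengthMeasure) (t : ℝ) :
    NullMeasurableSet {x | t < u x} Γ.lengthMeasure :=
  hu.aemeasurable.nullMeasurable measurableSet_Ioi

theorem disjoint_superlevel {Γ : MetricGraph V E} {W : Set V} {u : Γ.Point → ℝ}
    (h0 : ∀ v ∈ W, u (.vertex v) = 0) {t : ℝ} (ht : 0 < t) :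
    Disjoint {x | t < u x} (Point.vertex '' W) := by
  rw [disjoint_left]
  rintro _ hx ⟨v, hv, rfl⟩
  rw [mem_ofPred_eq, h0 v hv] at hx
  exact ht.not_gt hx

variable [Fintype E]

theorem IsTestField.neg {Γ : MetricGraph V E} {W : Set V} {z : E → ℝ → ℝ}
    (hz : Γ.IsTestField W z) : Γ.IsTestField W fun e x => -z e x where
  contDiff e := (hz.contDiff e).neg
  bound e x hx := by
    rw [abs_neg]
    exact hz.bound e x hx
  kirchhoff v hv := by
    have := hz.kirchhoff v hv
    simp only [flux, Finset.sum_neg_distrib] at this ⊢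
    linarith

theorem integral_deriv_testField {Γ : MetricGraph V E} {W : Set V} {z : E → ℝ → ℝ}
    (hz : Γ.IsTestField W z) (e : E) :
    ∫ x in (0 : ℝ)..Γ.len e, deriv (z e) x = z e (Γ.len e) - z e 0 :=
  intervalIntegral.integral_deriv_eq_sub
    (fun x _ => ((hz.contDiff e).differentiable (by norm_num)) x)
    (((hz.contDiff e).continuous_deriv le_rfl).intervalIntegrable _ _)

/-- The constant 1 pairs to zero with z by the fundamental theorem of calculus on each edge, even
though 1 does not vanish on W. -/
theorem derivPairing_one_sub {Γ : MetricGraph V E} {W : Set V} {u : Γ.Point → ℝ}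
    (hu : Integrable u Γ.lengthMeasure) {z : E → ℝ → ℝ} (hz : Γ.IsTestField W z) :
    Γ.derivPairing (1 - u) z = Γ.derivPairing u fun e x => -z e x := by
  refine Finset.sum_congr rfl fun e _ => ?_
  have hz' : Continuous (deriv (z e)) := (hz.contDiff e).continuous_deriv le_rfl
  have h1 : ∫ x in (0 : ℝ)..Γ.len e, (1 - u) (Γ.coord e x) * deriv (z e) x
      = z e (Γ.len e) - z e 0 - ∫ x in (0 : ℝ)..Γ.len e, u (Γ.coord e x) * deriv (z e) x := by
    rw [← integral_deriv_testField hz, ← intervalIntegral.integral_sub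
      (hz'.intervalIntegrable _ _)
      ((Γ.intervalIntegrable_coord hu e).mul_continuousOn hz'.continuousOn)]
    congr 1
    ext x
    simp only [Pi.sub_apply, Pi.one_apply]
    ring
  rw [h1, deriv.fun_neg']
  simp only [mul_neg, intervalIntegral.integral_neg, Pi.sub_apply, Pi.one_apply]
  ring

theorem totalVariation_one_sub_le (Γ : MetricGraph V E) (W : Set V) {u : Γ.Point → ℝ}
    (hu : Integrable u Γ.lengthMeasure) :
    Γ.totalVariation W (1 - u) ≤ Γ.totalVariation W u :=
  iSup₂_le fun z hz => by
    rw [derivPairing_one_sub hu hz]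
    exact le_iSup₂_of_le _ hz.neg le_rfl

theorem perimeter_compl_le (Γ : MetricGraph V E) (W : Set V) {D : Set Γ.Point}
    (hD : NullMeasurableSet D Γ.lengthMeasure) : Γ.perimeter W Dᶜ ≤ Γ.perimeter W D := by
  unfold perimeter
  rw [indicator_compl]
  exact Γ.totalVariation_one_sub_le W (Γ.integrable_indicator_one hD)

theorem cheegerConstant_mul_le_perimeter (Γ : MetricGraph V E) (W : Set V) {D : Set Γ.Point}
    (hD : NullMeasurableSet D Γ.lengthMeasure) (hW : Disjoint D (Point.vertex '' W)) :
    Γ.cheegerConstant W * Γ.lengthMeasure D ≤ Γ.perimeter W D := by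
  rcases eq_zero_or_pos (Γ.lengthMeasure D) with h | h
  · simp [h]
  · exact ENNReal.mul_le_of_le_div (iInf₂_le D ⟨hD, hW, h⟩)

/-- As u vanishes on W, superlevel sets of positive level and sublevel sets of negative level both
avoid W. In the negative case the perimeter is compared through the complement. -/
theorem cheegerConstant_mul_levelLength_le (Γ : MetricGraph V E) (W : Set V) {u : Γ.Point → ℝ}
    (hu : Integrable u Γ.lengthMeasure) (h0 : ∀ v ∈ W, u (.vertex v) = 0) {t : ℝ} (ht : t ≠ 0) :
    Γ.cheegerConstant W * Γ.levelLength u t ≤ Γ.perimeter W {x | t < u x} := by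
  have hm := Γ.nullMeasurableSet_lt hu t
  unfold levelLength
  split_ifs with h
  · exact Γ.cheegerConstant_mul_le_perimeter W hm (disjoint_superlevel h0 h)
  · have ht' : t < 0 := lt_of_le_of_ne (not_lt.mp h) ht
    have hc : {x | u x ≤ t} = {x | t < u x}ᶜ := by
      ext x
      simp
    rw [hc]
    refine (Γ.cheegerConstant_mul_le_perimeter W hm.compl ?_).trans (Γ.perimeter_compl_le W hm)
    rw [← hc, disjoint_left]
    rintro _ hx ⟨v, hv, rfl⟩
    rw [mem_ofPred_eq, h0 v hv] at hx
    exact ht'.not_ge hx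

theorem ae_cheegerConstant_mul_levelLength_le (Γ : MetricGraph V E) (W : Set V) {u : Γ.Point → ℝ}
    (hu : Integrable u Γ.lengthMeasure) (h0 : ∀ v ∈ W, u (.vertex v) = 0) :
    ∀ᵐ t : ℝ, Γ.cheegerConstant W * Γ.levelLength u t ≤ Γ.perimeter W {x | t < u x} := by
  filter_upwards [(countable_singleton (0 : ℝ)).ae_notMem volume] with t ht
  exact Γ.cheegerConstant_mul_levelLength_le W hu h0 ht

theorem cheegerConstant_mul_eLpNorm_le [Finite V] (Γ : MetricGraph V E) (W : Set V)
    {u : Γ.Point → ℝ} (hu : Integrable u Γ.lengthMeasure) (h0 : ∀ v ∈ W, u (.vertex v) = 0) :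
    Γ.cheegerConstant W * eLpNorm u 1 Γ.lengthMeasure ≤ Γ.totalVariation W u := by
  obtain ⟨g, -, hPg, hg⟩ := Γ.exists_measurable_perimeter_le W hu
  rw [← Γ.lintegral_levelLength hu]
  refine (lintegral_const_mul_le _ _).trans ((lintegral_mono_ae ?_).trans hg)
  filter_upwards [hPg, Γ.ae_cheegerConstant_mul_levelLength_le W hu h0] with t h1 h2
  exact h2.trans h1

theorem Admissible.eLpNorm_ne_zero {Γ : MetricGraph V E} {W : Set V} {u : Γ.Point → ℝ}
    (hu : Γ.Admissible W u) : eLpNorm u 1 Γ.lengthMeasure ≠ 0 := fun h =>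
  hu.ne_zero ((eLpNorm_eq_zero_iff hu.memBV.1.aestronglyMeasurable one_ne_zero).mp h)

theorem Admissible.eLpNorm_ne_top {Γ : MetricGraph V E} {W : Set V} {u : Γ.Point → ℝ}
    (hu : Γ.Admissible W u) : eLpNorm u 1 Γ.lengthMeasure ≠ ⊤ :=
  (memLp_one_iff_integrable.mpr hu.memBV.1).eLpNorm_ne_top

theorem totalVariation_empty_le (Γ : MetricGraph V E) (W : Set V) (u : Γ.Point → ℝ) :
    Γ.totalVariation ∅ u ≤ Γ.totalVariation W u :=
  iSup₂_le fun z hz =>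
    le_iSup₂_of_le z ⟨hz.contDiff, hz.bound, fun v _ => hz.kirchhoff v (notMem_empty v)⟩ le_rfl

theorem CheegerAdmissible.admissible_indicator {Γ : MetricGraph V E} {W : Set V}
    {D : Set Γ.Point} (hD : Γ.CheegerAdmissible W D) (hP : Γ.perimeter W D ≠ ⊤) :
    Γ.Admissible W (D.indicator 1) where
  memBV := ⟨Γ.integrable_indicator_one hD.measurable,
    ne_top_of_le_ne_top hP (Γ.totalVariation_empty_le W _)⟩
  dirichlet v hv := indicator_of_notMem
    (fun h => disjoint_left.mp hD.disjoint h (mem_image_of_mem _ hv)) _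
  ne_zero h := by
    have := eLpNorm_congr_ae (p := 1) h
    rw [Γ.eLpNorm_indicator_one hD.measurable, eLpNorm_zero] at this
    exact hD.pos.ne' this

/-! ### The eigenvalue identity and the level sets of minimizers. -/

/-- The first eigenvalue equals the Cheeger constant. -/
theorem firstEigenvalue_eq_cheegerConstant [Finite V] (Γ : MetricGraph V E) (W : Set V) :
    Γ.firstEigenvalue W = Γ.cheegerConstant W := by
  refine le_antisymm (le_iInf₂ fun D hD => ?_) (le_iInf₂ fun u hu => ?_)
  -- A set of infinite perimeter need not have an admissible indicator, but its quotient is infinite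
  -- because its length is finite.
  · by_cases hP : Γ.perimeter W D = ⊤
    · rw [hP, ENNReal.top_div_of_ne_top (measure_ne_top _ _)]
      exact le_top
    · refine (iInf₂_le _ (hD.admissible_indicator hP)).trans (le_of_eq ?_)
      rw [rayleigh, Γ.eLpNorm_indicator_one hD.measurable, perimeter]
  · rw [rayleigh, ENNReal.le_div_iff_mul_le (Or.inl hu.eLpNorm_ne_zero) (Or.inl hu.eLpNorm_ne_top)]
    exact Γ.cheegerConstant_mul_eLpNorm_le W hu.memBV.1 hu.dirichlet

/-- The union of the open edges avoids every W and has perimeter at most 2 per edge, one for each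
end. It serves as the competitor showing that λ is finite. -/
theorem perimeter_compl_range_vertex_ne_top (Γ : MetricGraph V E) (W : Set V) :
    Γ.perimeter W (range Point.vertex)ᶜ ≠ ⊤ := by
  refine ne_top_of_le_ne_top (ENNReal.ofReal_ne_top (r := ∑ _e : E, 2)) (iSup₂_le fun z hz => ?_)
  refine ENNReal.ofReal_le_ofReal (Finset.sum_le_sum fun e _ => ?_)
  have hint : ∫ x in (0 : ℝ)..Γ.len e,
      (range Point.vertex)ᶜ.indicator 1 (Γ.coord e x) * deriv (z e) x
      = z e (Γ.len e) - z e 0 := by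
    rw [← integral_deriv_testField hz, intervalIntegral.integral_of_le (Γ.len_pos e).le,
      intervalIntegral.integral_of_le (Γ.len_pos e).le, integral_Ioc_eq_integral_Ioo,
      integral_Ioc_eq_integral_Ioo]
    refine setIntegral_congr_fun measurableSet_Ioo fun x hx => ?_
    rw [Γ.coord_of_mem hx]
    simp
  have h1 := abs_le.mp (hz.bound e 0 (left_mem_Icc.mpr (Γ.len_pos e).le))
  have h2 := abs_le.mp (hz.bound e (Γ.len e) (right_mem_Icc.mpr (Γ.len_pos e).le))
  rw [hint]
  simp only [mem_compl_iff, mem_range, exists_apply_eq_apply, not_true_eq_false, not_false_eq_true,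
    indicator_of_notMem]
  linarith

theorem cheegerConstant_ne_top (Γ : MetricGraph V E) (W : Set V) (hΓ : Γ.lengthMeasure ≠ 0) :
    Γ.cheegerConstant W ≠ ⊤ := by
  obtain ⟨h0, hm⟩ := Γ.lengthMeasure_range_vertex
  have hpos : Γ.lengthMeasure (range Point.vertex)ᶜ ≠ 0 := fun h => hΓ <| by
    rw [← Measure.measure_univ_eq_zero, ← union_compl_self (range (Point.vertex : V → Γ.Point))]
    exact measure_union_null h0 h
  refine ne_top_of_le_ne_top (ENNReal.div_ne_top (Γ.perimeter_compl_range_vertex_ne_top W) hpos)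
    (iInf₂_le _ ⟨hm.compl.nullMeasurableSet, ?_, pos_iff_ne_zero.mpr hpos⟩)
  exact disjoint_compl_left_iff_subset.mpr (image_subset_range _ _)

/-- Almost every positive superlevel set of a minimizer has the optimal perimeter. -/
theorem ae_perimeter_eq_of_rayleigh_eq [Finite V] (Γ : MetricGraph V E) (W : Set V)
    {u : Γ.Point → ℝ} (hu : Γ.Admissible W u) (hmin : Γ.rayleigh W u = Γ.firstEigenvalue W) :
    ∀ᵐ t : ℝ, 0 < t → Γ.perimeter W {x | t < u x}
      = Γ.cheegerConstant W * Γ.lengthMeasure {x | t < u x} := by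
  have hui := hu.memBV.1
  have hne : Γ.lengthMeasure ≠ 0 := fun h => hu.ne_zero (by simp [h, Filter.EventuallyEq])
  have hTV : Γ.totalVariation W u = Γ.cheegerConstant W * eLpNorm u 1 Γ.lengthMeasure := by
    rw [← Γ.firstEigenvalue_eq_cheegerConstant, ← hmin, rayleigh,
      ENNReal.div_mul_cancel hu.eLpNorm_ne_zero hu.eLpNorm_ne_top]
  have hTVfin : Γ.totalVariation W u ≠ ⊤ := by
    rw [hTV]
    exact ENNReal.mul_ne_top (Γ.cheegerConstant_ne_top W hne) hu.eLpNorm_ne_top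
  obtain ⟨g, hgm, hPg, hg⟩ := Γ.exists_measurable_perimeter_le W hui
  have hle := Γ.ae_cheegerConstant_mul_levelLength_le W hui hu.dirichlet
  have hleg : ∀ᵐ t : ℝ, Γ.cheegerConstant W * Γ.levelLength u t ≤ g t := by
    filter_upwards [hPg, hle] with t h1 h2
    exact h2.trans h1
  -- Minimality bounds the integral of g by that of the smaller function. Finiteness then forces
  -- equality almost everywhere, and the perimeter lies between the two.
  have heq := ae_eq_of_ae_le_of_lintegral_le hleg
    (ne_top_of_le_ne_top hTVfin ((lintegral_mono_ae hleg).trans hg)) hgm.aemeasurable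
    (hg.trans (by
      rw [hTV, ← Γ.lintegral_levelLength hui]
      exact lintegral_const_mul_le _ _))
  filter_upwards [hPg, hle, heq] with t h1 h2 h3 ht
  have hlen : Γ.levelLength u t = Γ.lengthMeasure {x | t < u x} := if_pos ht
  rw [← hlen]
  exact le_antisymm (h1.trans h3.symm.le) h2

end MetricGraph

theorem mainTheorem9 {V E : Type*} [Finite V] [Fintype E] (Γ : MetricGraph V E)
    (hΓ : Γ.Connected) (V_D : Set V) (hV_D : V_D.Nonempty) :
    Γ.firstEigenvalue V_D = Γ.cheegerConstant V_D ∧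
    ∀ u : Γ.Point → ℝ, Γ.Admissible V_D u → Γ.rayleigh V_D u = Γ.firstEigenvalue V_D →
      ∀ᵐ t : ℝ, 0 < t →
        Γ.perimeter V_D {x | t < u x}
          = Γ.cheegerConstant V_D * Γ.lengthMeasure {x | t < u x} ∧
        (0 < Γ.lengthMeasure {x | t < u x} → Γ.IsCheegerSet V_D {x | t < u x}) := by
  refine ⟨Γ.firstEigenvalue_eq_cheegerConstant V_D, fun u hu hmin => ?_⟩
  filter_upwards [Γ.ae_perimeter_eq_of_rayleigh_eq V_D hu hmin] with t h ht
  refine ⟨h ht, fun hpos => ⟨⟨Γ.nullMeasurableSet_lt hu.memBV.1 t,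
    MetricGraph.disjoint_superlevel hu.dirichlet ht, hpos⟩, ?_⟩⟩
  rw [h ht, ENNReal.mul_div_cancel_right hpos.ne' (measure_ne_top _ _)]
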